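/- Let $A$ be a (not necessarily unital) $C^*$-algebra and let $A^{**}$ be its enveloping von Neumann algebra, i.e. its Banach space bidual with its canonical norm and involution and with the order in which $x\le y$ iff $\varphi(x)\le\varphi(y)$, in the sense that $\varphi(y-x)\in[0,\infty)$, for every positive functional $\varphi$ on $A$ (extended canonically to $A^{**}$). For $R\subset A^{**}$ let $R_{\mathrm{sa}}=\{x\in R:x^*=x\}$, and let $(R_{\mathrm{sa}})^m$ be the set of (weak$^*$, i.e. $\sigma$-weak) limits of bounded increasing nets from $R_{\mathrm{sa}}$. An element $h\in A^{**}$ is strongly lower semicontinuous if it lies in the norm closure $((A_{\mathrm{sa}})^m)^-$ of $(A_{\mathrm{sa}})^m$, and $k$ is strongly upper semicontinuous if $-k$ is strongly lower semicontinuous. Define the following subsets of $A^{**}_{\mathrm{sa}}$. * $\overline S(A)$ is the norm closed real vector space generated by $((A_{\mathrm{sa}})^m)^-$. * $\mathcal U(A)$ is the set of $x\in A^{**}_{\mathrm{sa}}$ such that for every $\epsilon>0$ and every state $\varphi$ of $A$ there are a strongly lower semicontinuous $h$ and a strongly upper semicontinuous $k$ with $k\le x\le h$ and $\varphi(h-k)<\epsilon$.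 * $\mathcal U_b(A)$ is the set of $x\in A^{**}_{\mathrm{sa}}$ for which there is a constant $\gamma$, depending only on $x$, such that $h$ and $k$ as in the definition of $\mathcal U(A)$ can always be chosen with $\|h\|,\|k\|\le\gamma$. * $\overline{\mathcal U}_b(A)$ is the norm closure of $\mathcal U_b(A)$. * $\mathcal U_0(A)$ is the monotone sequential closure of $\mathcal U_b(A)$, i.e. the smallest set containing $\mathcal U_b(A)$ that contains the limit of each bounded increasing or decreasing sequence of its elements. Let $n\ge 1$, let $\mathbb M_n(A)$ be the $C^*$-algebra of $n\times n$ matrices over $A$, identify $\mathbb M_n(A)^{**}$ with $\mathbb M_n(A^{**})$ in the canonical way, and for $x\in A^{**}$ let $xe_{11}\in\mathbb M_n(A^{**})$ be the matrix with $(1,1)$ entry $x$ and all other entries $0$. Then for every $x\in A^{**}_{\mathrm{sa}}$: 1. $x\in\overline S(A)$ if and only if $xe_{11}\in\overline S(\mathbb M_n(A))$; 2. $x\in\mathcal U_b(A)$ if and only if $xe_{11}\in\mathcal U_b(\mathbb M_n(A))$; 3. $x\in\overline{\mathcal U}_b(A)$ if and only if $xe_{11}\in\overline{\mathcal U}_b(\mathbb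 M_n(A))$; 4. $x\in\mathcal U_0(A)$ if and only if $xe_{11}\in\mathcal U_0(\mathbb M_n(A))$; 5. $x\in\mathcal U(A)$ if and only if $xe_{11}\in\mathcal U(\mathbb M_n(A))$. -/

import Mathlib

open Filter Topology

namespace CStarBidual

universe u

noncomputable section

/-- `A**`, realised as the Banach space bidual of the C*-algebra `A`. -/
abbrev Bidual (A : Type u) [NonUnitalCStarAlgebra A] : Type u :=
  StrongDual ℂ (StrongDual ℂ A)

section Single

variable {A : Type u} [NonUnitalCStarAlgebra A]

/-- The canonical embedding `A → A**`. -/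
def incl : A →L[ℂ] Bidual A := NormedSpace.inclusionInDoubleDual ℂ A

/-- The involution of `A*`: `φ*(a) = conj (φ (a*))`. -/
def dualStar : StrongDual ℂ A →L⋆[ℂ] StrongDual ℂ A :=
  LinearMap.mkContinuous
    { toFun := fun φ =>
        ((starL ℂ : ℂ ≃L⋆[ℂ] ℂ) : ℂ →L⋆[ℂ] ℂ).comp
          (φ.comp ((starL ℂ : A ≃L⋆[ℂ] A) : A →L⋆[ℂ] A))
      map_add' := by intro φ ψ; ext a; simp
      map_smul' := by intro c φ; ext a; simp }
    1 (by
      intro φ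
      refine ContinuousLinearMap.opNorm_le_bound _ (by positivity) fun a => ?_
      simpa using φ.le_opNorm (star a))

theorem dualStar_apply (φ : StrongDual ℂ A) (a : A) :
    dualStar φ a = star (φ (star a)) := rfl

/-- The involution of `A**`: `x*(φ) = conj (x (φ*))`. -/
def bidualStar (x : Bidual A) : Bidual A :=
  ((starL ℂ : ℂ ≃L⋆[ℂ] ℂ) : ℂ →L⋆[ℂ] ℂ).comp (x.comp dualStar)

theorem bidualStar_apply (x : Bidual A) (φ : StrongDual ℂ A) :
    bidualStar x φ = star (x (dualStar φ)) := rfl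

/-- The involution of `A**` extends that of `A`. -/
theorem bidualStar_incl (a : A) : bidualStar (incl a) = incl (star a) := by
  ext φ
  simp [bidualStar_apply, incl, dualStar_apply]

/-- Positive functionals on `A`. -/
def IsPositive (φ : StrongDual ℂ A) : Prop := ∀ a : A, 0 ≤ (φ (star a * a)).re ∧
  (φ (star a * a)).im = 0

/-- States of `A`. -/
def IsState (φ : StrongDual ℂ A) : Prop := IsPositive φ ∧ ‖φ‖ = 1

/-- The order of `A**`: `x ≤ y` iff `y - x` takes nonnegative real values at all
positive functionals on `A`. -/
def Le (x y : Bidual A) : Prop :=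
  ∀ φ : StrongDual ℂ A, IsPositive φ → 0 ≤ ((y - x) φ).re ∧ ((y - x) φ).im = 0

/-- `R_sa`, the self-adjoint elements of `R ⊆ A**`. -/
def saPart (R : Set (Bidual A)) : Set (Bidual A) := {x | x ∈ R ∧ bidualStar x = x}

/-- Convergence in the weak* (that is, σ-weak) topology of `A**`. -/
def WeakStarTendsto {ι : Type*} (x : ι → Bidual A) (l : Filter ι) (y : Bidual A) : Prop :=
  ∀ φ : StrongDual ℂ A, Tendsto (fun i => x i φ) l (𝓝 (y φ))

/-- `(R_sa)^m`, the set of limits of bounded increasing nets from `R_sa`. -/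
def monoLimits (R : Set (Bidual A)) : Set (Bidual A) :=
  {y | ∃ (ι : Type u) (_ : Preorder ι) (_ : IsDirectedOrder ι) (_ : Nonempty ι)
      (x : ι → Bidual A),
      (∀ i, x i ∈ saPart R) ∧ (∀ i j, i ≤ j → Le (x i) (x j)) ∧
      (∃ C : ℝ, ∀ i, ‖x i‖ ≤ C) ∧ WeakStarTendsto x atTop y}

variable (A) in
/-- The strongly lower semicontinuous elements of `A**`: the norm closure of `(A_sa)^m`. -/
def stronglyLSC : Set (Bidual A) := closure (monoLimits (Set.range (incl (A := A))))

variable (A) in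
/-- The strongly upper semicontinuous elements of `A**`. -/
def stronglyUSC : Set (Bidual A) := {k | -k ∈ stronglyLSC A}

variable (A) in
/-- `S̄(A)`: the norm closed real vector space generated by the strongly lower
semicontinuous elements. -/
def SBar : Set (Bidual A) := closure (Submodule.span ℝ (stronglyLSC A) : Set (Bidual A))

variable (A) in
/-- `𝒰(A)`: the universally measurable self-adjoint elements of `A**`. -/
def U : Set (Bidual A) :=
  {x | bidualStar x = x ∧ ∀ ε : ℝ, 0 < ε → ∀ φ : StrongDual ℂ A, IsState φ →
    ∃ h ∈ stronglyLSC A, ∃ k ∈ stronglyUSC A, Le k x ∧ Le x h ∧ ((h - k) φ).re < ε}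

variable (A) in
/-- `𝒰_b(A)`: as `𝒰(A)`, with `h` and `k` bounded in norm by a constant depending only
on `x`. -/
def Ub : Set (Bidual A) :=
  {x | bidualStar x = x ∧ ∃ γ : ℝ, ∀ ε : ℝ, 0 < ε → ∀ φ : StrongDual ℂ A, IsState φ →
    ∃ h ∈ stronglyLSC A, ∃ k ∈ stronglyUSC A, ‖h‖ ≤ γ ∧ ‖k‖ ≤ γ ∧
      Le k x ∧ Le x h ∧ ((h - k) φ).re < ε}

variable (A) in
/-- The norm closure of `𝒰_b(A)`. -/
def UbBar : Set (Bidual A) := closure (Ub A)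

/-- `T` contains the limits of all bounded, increasing or decreasing sequences from `T`. -/
def SeqMonoClosed (T : Set (Bidual A)) : Prop :=
  ∀ (x : ℕ → Bidual A) (y : Bidual A), (∀ i, x i ∈ T) →
    ((∀ i j, i ≤ j → Le (x i) (x j)) ∨ (∀ i j, i ≤ j → Le (x j) (x i))) →
    (∃ C : ℝ, ∀ i, ‖x i‖ ≤ C) → WeakStarTendsto x atTop y → y ∈ T

variable (A) in
/-- `𝒰_0(A)`: the monotone sequential closure of `𝒰_b(A)`, i.e. the smallest set that contains
`𝒰_b(A)` and is closed under monotone sequential limits. -/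
def U0 : Set (Bidual A) := ⋂₀ {T | Ub A ⊆ T ∧ SeqMonoClosed T}

end Single

section Mat

variable {A : Type u} [NonUnitalCStarAlgebra A] [PartialOrder A] [StarOrderedRing A] {n : ℕ}

/-- The C*-algebra `M_n(A)`. -/
abbrev Mat (n : ℕ) (A : Type u) : Type u := CStarMatrix (Fin n) (Fin n) A

/-- The map `M ↦ M i j` from `M_n(A)` to `A`. -/
def entryL (i j : Fin n) : Mat n A →L[ℂ] A where
  toFun M := M i j
  map_add' _ _ := rfl
  map_smul' _ _ := rfl
  cont := (continuous_apply j).comp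
    ((continuous_apply i : Continuous fun M : Fin n → Fin n → A => M i))

/-- The map `a ↦ a e_ij` from `A` to `M_n(A)`. -/
def singleL (i j : Fin n) : A →L[ℂ] Mat n A where
  toFun a := CStarMatrix.ofMatrix (Matrix.single i j a)
  map_add' a b := by
    rw [Matrix.single_add]; rfl
  map_smul' c a := by
    rw [RingHom.id_apply, ← Matrix.smul_single]; rfl
  cont := (CStarMatrix.ofMatrixL (m := Fin n) (n := Fin n) (A := A)).continuous.comp
    (continuous_matrix fun k l => by
      by_cases h : i = k ∧ j = l
      · obtain ⟨rfl, rfl⟩ := h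
        simpa using (continuous_id' (X := A))
      · simpa [Matrix.single_apply, h] using continuous_const)

theorem entryL_singleL (i j k l : Fin n) (a : A) :
    entryL k l (singleL i j a) = if i = k ∧ j = l then a else 0 :=
  Matrix.single_apply i j a k l

theorem sum_singleL_entryL (M : Mat n A) :
    ∑ i, ∑ j, singleL i j (entryL i j M) = M :=
  (Matrix.matrix_eq_sum_single (CStarMatrix.ofMatrix.symm M)).symm

/-- The canonical identification of `M_n(A)**` with `M_n(A**)`: the entries of `X` are its images
under the second adjoints of the entry maps. -/
def matEquiv (n : ℕ) (A : Type u) [NonUnitalCStarAlgebra A] [PartialOrder A]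
    [StarOrderedRing A] :
    Bidual (Mat n A) ≃ₗ[ℂ] Matrix (Fin n) (Fin n) (Bidual A) where
  toFun X := Matrix.of fun i j =>
    X.comp ((ContinuousLinearMap.compL ℂ (Mat n A) A ℂ).flip (entryL i j))
  map_add' X Y := by ext; rfl
  map_smul' c X := by ext; rfl
  invFun x := ∑ i, ∑ j,
    (x i j).comp ((ContinuousLinearMap.compL ℂ A (Mat n A) ℂ).flip (singleL i j))
  left_inv X := by
    ext f
    have hf : f = ∑ i, ∑ j, (f.comp (singleL i j)).comp (entryL i j) := by
      ext M
      conv_lhs => rw [← sum_singleL_entryL M]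
      simp [map_sum]
    conv_rhs => rw [hf]
    simp [map_sum]
  right_inv x := by
    ext k l φ
    have h : ∀ i j : Fin n, (φ.comp (entryL k l)).comp (singleL (A := A) i j)
        = if i = k ∧ j = l then φ else 0 := by
      intro i j
      ext a
      by_cases hij : i = k ∧ j = l <;> simp [entryL_singleL, hij]
    simp only [Matrix.of_apply, ContinuousLinearMap.comp_apply, _root_.sum_apply,
      ContinuousLinearMap.flip_apply, ContinuousLinearMap.compL_apply, h]
    rw [Finset.sum_eq_single k, Finset.sum_eq_single l]
    · simp
    · intro j _ hj; simp [hj]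
    · simp
    · intro i _ hi; simp [hi]
    · simp

/-- The identification of `M_n(A)**` with `M_n(A**)` extends the identity of `M_n(A)`. -/
theorem matEquiv_incl (M : Mat n A) (i j : Fin n) :
    matEquiv n A (incl M) i j = incl (M i j) := rfl

/-- For `x ∈ A**`, the element `x e₁₁` of `M_n(A**) = M_n(A)**`
(rows and columns are numbered from `0`). -/
def e11 (n : ℕ) [NeZero n] (x : Bidual A) : Bidual (Mat n A) :=
  (matEquiv n A).symm (Matrix.single 0 0 x)

end Mat

end

end CStarBidual

/-! The corner embedding `a ↦ a e₁₁` and the compression to the `(1,1)` entry both respect the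
involution and pull positive functionals back to positive ones. Hence their second adjoints are
bounded, weak*-continuous and order preserving, and carry each of the five classes into its
counterpart. The first sends `x` to `x e₁₁` and the second undoes it, so both directions of every
equivalence follow from one transfer argument. The only delicate point is that the classes built on
states are tested against pullbacks that need not be states. A nonzero pullback is rescaled. For a
zero pullback any state of the source supplies `h` and `k`, so it must be known that `A` has a state
if and only if `M_n(A)` does. -/

namespace CStarBidual

universe u

/-! ### Transfer along second adjoints of star-preserving positive maps -/

section SecondAdjoint

variable {A B : Type u} [NonUnitalCStarAlgebra A] [NonUnitalCStarAlgebra B]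

theorem IsPositive.smul {φ : StrongDual ℂ A} (hφ : IsPositive φ) {t : ℝ} (ht : 0 ≤ t) :
    IsPositive ((t : ℂ) • φ) := fun a => by
  obtain ⟨h1, h2⟩ := hφ a
  simp [h2, mul_nonneg ht h1]

theorem IsPositive.isState_normalize {φ : StrongDual ℂ A} (hφ : IsPositive φ) (h0 : φ ≠ 0) :
    IsState (((‖φ‖⁻¹ : ℝ) : ℂ) • φ) := by
  refine ⟨hφ.smul (by positivity), ?_⟩
  have : ‖φ‖ ≠ 0 := norm_ne_zero_iff.2 h0
  rw [norm_smul, Complex.norm_real, norm_inv, norm_norm, inv_mul_cancel₀ this]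

theorem IsState.ne_zero {φ : StrongDual ℂ A} (hφ : IsState φ) : φ ≠ 0 := by
  rintro rfl
  simpa using hφ.2

/-- The second adjoint `A** → B**` of a bounded linear map `A → B`. -/
noncomputable def secondAdjoint (T : A →L[ℂ] B) : Bidual A →L[ℂ] Bidual B :=
  (ContinuousLinearMap.compL ℂ (StrongDual ℂ B) (StrongDual ℂ A) ℂ).flip
    ((ContinuousLinearMap.compL ℂ A B ℂ).flip T)

theorem secondAdjoint_apply (T : A →L[ℂ] B) (x : Bidual A) (φ : StrongDual ℂ B) :
    secondAdjoint T x φ = x (φ.comp T) := rfl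

theorem secondAdjoint_incl (T : A →L[ℂ] B) (a : A) :
    secondAdjoint T (incl a) = incl (T a) := rfl

theorem norm_secondAdjoint_apply_le (T : A →L[ℂ] B) (x : Bidual A) :
    ‖secondAdjoint T x‖ ≤ ‖T‖ * ‖x‖ := by
  refine ContinuousLinearMap.opNorm_le_bound _ (by positivity) fun φ => ?_
  calc ‖x (φ.comp T)‖ ≤ ‖x‖ * (‖φ‖ * ‖T‖) := x.le_opNorm_of_le (φ.opNorm_comp_le T)
    _ = ‖T‖ * ‖x‖ * ‖φ‖ := by ring

theorem norm_secondAdjoint_apply_le_of_le (T : A →L[ℂ] B) {x : Bidual A} {C : ℝ}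
    (h : ‖x‖ ≤ C) : ‖secondAdjoint T x‖ ≤ ‖T‖ * C :=
  (norm_secondAdjoint_apply_le T x).trans (by gcongr)

/-- A bounded linear map that preserves the involution and pulls positive functionals back to
positive functionals. -/
structure IsStarPositive (T : A →L[ℂ] B) : Prop where
  map_star (a : A) : T (star a) = star (T a)
  comp_isPositive (φ : StrongDual ℂ B) : IsPositive φ → IsPositive (φ.comp T)

variable {T : A →L[ℂ] B}

theorem WeakStarTendsto.secondAdjoint {ι : Type*} {x : ι → Bidual A} {l : Filter ι}
    {y : Bidual A} (h : WeakStarTendsto x l y) :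
    WeakStarTendsto (fun i => secondAdjoint T (x i)) l (secondAdjoint T y) :=
  fun φ => h (φ.comp T)

theorem exists_norm_secondAdjoint_le {ι : Type*} {x : ι → Bidual A}
    (h : ∃ C : ℝ, ∀ i, ‖x i‖ ≤ C) : ∃ C : ℝ, ∀ i, ‖secondAdjoint T (x i)‖ ≤ C := by
  obtain ⟨C, hC⟩ := h
  exact ⟨‖T‖ * C, fun i => norm_secondAdjoint_apply_le_of_le T (hC i)⟩

namespace IsStarPositive

theorem secondAdjoint_le (hT : IsStarPositive T) {x y : Bidual A} (h : Le x y) :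
    Le (secondAdjoint T x) (secondAdjoint T y) :=
  fun φ hφ => h (φ.comp T) (hT.comp_isPositive φ hφ)

theorem bidualStar_secondAdjoint (hT : IsStarPositive T) (x : Bidual A) :
    bidualStar (secondAdjoint T x) = secondAdjoint T (bidualStar x) := by
  ext φ
  have : (dualStar φ).comp T = dualStar (φ.comp T) := by
    ext a
    simp [dualStar_apply, hT.map_star]
  simp [bidualStar_apply, secondAdjoint_apply, this]

theorem secondAdjoint_mem_monoLimits (hT : IsStarPositive T) {x : Bidual A}
    (hx : x ∈ monoLimits (Set.range (incl (A := A)))) :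
    secondAdjoint T x ∈ monoLimits (Set.range (incl (A := B))) := by
  obtain ⟨ι, i1, i2, i3, y, hy, hmono, hC, hlim⟩ := hx
  refine ⟨ι, i1, i2, i3, fun i => secondAdjoint T (y i), fun i => ⟨?_, ?_⟩,
    fun i j hij => hT.secondAdjoint_le (hmono i j hij), exists_norm_secondAdjoint_le hC,
    hlim.secondAdjoint⟩
  · obtain ⟨a, ha⟩ := (hy i).1
    exact ⟨T a, by simp only [← ha, secondAdjoint_incl]⟩
  · rw [hT.bidualStar_secondAdjoint, (hy i).2]

theorem secondAdjoint_mem_stronglyLSC (hT : IsStarPositive T) {x : Bidual A}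
    (hx : x ∈ stronglyLSC A) : secondAdjoint T x ∈ stronglyLSC B :=
  map_mem_closure (secondAdjoint T).continuous hx fun _ => hT.secondAdjoint_mem_monoLimits

theorem secondAdjoint_mem_stronglyUSC (hT : IsStarPositive T) {x : Bidual A}
    (hx : x ∈ stronglyUSC A) :     secondAdjoint T x ∈ stronglyUSC B :=
  hT.secondAdjoint_mem_stronglyLSC hx

theorem secondAdjoint_mem_SBar (hT : IsStarPositive T) {x : Bidual A} (hx : x ∈ SBar A) :
    secondAdjoint T x ∈ SBar B := by
  refine map_mem_closure (secondAdjoint T).continuous hx fun y hy => ?_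
  have : Submodule.span ℝ (stronglyLSC A) ≤ (Submodule.span ℝ (stronglyLSC B)).comap
      ((secondAdjoint T).restrictScalars ℝ : Bidual A →ₗ[ℝ] Bidual B) :=
    Submodule.span_le.2 fun z hz =>
      Submodule.subset_span (hT.secondAdjoint_mem_stronglyLSC hz)
  exact this hy

/-- If `A` has a state, then the approximation condition defining `𝒰(A)` passes from the states of
`A` to the pullbacks of states of `B`, which need not be normalized. -/
theorem exists_approx (hT : IsStarPositive T)
    (hS : (∃ φ : StrongDual ℂ B, IsState φ) → ∃ φ : StrongDual ℂ A, IsState φ)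
    {P : Bidual A → Bidual A → Prop}
    (h : ∀ ε : ℝ, 0 < ε → ∀ φ : StrongDual ℂ A, IsState φ →
      ∃ h k, P h k ∧ ((h - k) φ).re < ε)
    {ε : ℝ} (hε : 0 < ε) {φ : StrongDual ℂ B} (hφ : IsState φ) :
    ∃ h k, P h k ∧ ((secondAdjoint T h - secondAdjoint T k) φ).re < ε := by
  change ∃ h k, P h k ∧ ((h - k) (φ.comp T)).re < ε
  -- If the pullback vanishes, the estimate is trivial; a state is needed only to produce some pair
  -- satisfying `P`.
  by_cases h0 : φ.comp T = 0
  · obtain ⟨ψ, hψ⟩ := hS ⟨φ, hφ⟩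
    obtain ⟨u, v, huv, -⟩ := h ε hε ψ hψ
    exact ⟨u, v, huv, by simpa [h0] using hε⟩
  · have ht : 0 < ‖φ.comp T‖ := norm_pos_iff.2 h0
    -- The tolerance is rescaled by the same factor as the functional, so the factor cancels.
    obtain ⟨u, v, huv, hlt⟩ := h (‖φ.comp T‖⁻¹ * ε) (by positivity) _
      ((hT.comp_isPositive φ hφ.1).isState_normalize h0)
    refine ⟨u, v, huv, ?_⟩
    rw [map_smul, smul_eq_mul, Complex.re_ofReal_mul] at hlt
    exact lt_of_mul_lt_mul_left hlt (by positivity)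

theorem secondAdjoint_mem_U (hT : IsStarPositive T)
    (hS : (∃ φ : StrongDual ℂ B, IsState φ) → ∃ φ : StrongDual ℂ A, IsState φ)
    {x : Bidual A} (hx : x ∈ U A) : secondAdjoint T x ∈ U B := by
  refine ⟨by rw [hT.bidualStar_secondAdjoint, hx.1], fun ε hε φ hφ => ?_⟩
  obtain ⟨u, v, ⟨hu, hv, hvx, hxu⟩, hlt⟩ := hT.exists_approx hS
    (P := fun u v => u ∈ stronglyLSC A ∧ v ∈ stronglyUSC A ∧ Le v x ∧ Le x u)
    (fun ε hε φ hφ => by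
      obtain ⟨u, hu, v, hv, h1, h2, h3⟩ := hx.2 ε hε φ hφ
      exact ⟨u, v, ⟨hu, hv, h1, h2⟩, h3⟩) hε hφ
  exact ⟨_, hT.secondAdjoint_mem_stronglyLSC hu, _, hT.secondAdjoint_mem_stronglyUSC hv,
    hT.secondAdjoint_le hvx, hT.secondAdjoint_le hxu, hlt⟩

theorem secondAdjoint_mem_Ub (hT : IsStarPositive T)
    (hS : (∃ φ : StrongDual ℂ B, IsState φ) → ∃ φ : StrongDual ℂ A, IsState φ)
    {x : Bidual A} (hx : x ∈ Ub A) : secondAdjoint T x ∈ Ub B := by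
  obtain ⟨hsa, γ, hγ⟩ := hx
  refine ⟨by rw [hT.bidualStar_secondAdjoint, hsa], ‖T‖ * γ, fun ε hε φ hφ => ?_⟩
  obtain ⟨u, v, ⟨hu, hv, hun, hvn, hvx, hxu⟩, hlt⟩ := hT.exists_approx hS
    (P := fun u v => u ∈ stronglyLSC A ∧ v ∈ stronglyUSC A ∧ ‖u‖ ≤ γ ∧ ‖v‖ ≤ γ ∧
      Le v x ∧ Le x u)
    (fun ε hε φ hφ => by
      obtain ⟨u, hu, v, hv, h1, h2, h3, h4, h5⟩ := hγ ε hε φ hφ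
      exact ⟨u, v, ⟨hu, hv, h1, h2, h3, h4⟩, h5⟩) hε hφ
  exact ⟨_, hT.secondAdjoint_mem_stronglyLSC hu, _, hT.secondAdjoint_mem_stronglyUSC hv,
    norm_secondAdjoint_apply_le_of_le T hun, norm_secondAdjoint_apply_le_of_le T hvn,
    hT.secondAdjoint_le hvx, hT.secondAdjoint_le hxu, hlt⟩

theorem secondAdjoint_mem_UbBar (hT : IsStarPositive T)
    (hS : (∃ φ : StrongDual ℂ B, IsState φ) → ∃ φ : StrongDual ℂ A, IsState φ)
    {x : Bidual A} (hx : x ∈ UbBar A) : secondAdjoint T x ∈ UbBar B :=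
  map_mem_closure (secondAdjoint T).continuous hx fun _ => hT.secondAdjoint_mem_Ub hS

/-- The preimage of a competitor in the intersection defining `U0 B` is a competitor for `U0 A`,
because monotone bounded limits are preserved. -/
theorem secondAdjoint_mem_U0 (hT : IsStarPositive T)
    (hS : (∃ φ : StrongDual ℂ B, IsState φ) → ∃ φ : StrongDual ℂ A, IsState φ)
    {x : Bidual A} (hx : x ∈ U0 A) : secondAdjoint T x ∈ U0 B := by
  rintro R ⟨hUb, hR⟩
  refine hx (secondAdjoint T ⁻¹' R) ⟨fun y hy => hUb (hT.secondAdjoint_mem_Ub hS hy), ?_⟩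
  intro y z hy hmono hC hlim
  exact hR (fun i => secondAdjoint T (y i)) _ hy
    (hmono.imp (fun h i j hij => hT.secondAdjoint_le (h i j hij))
      (fun h i j hij => hT.secondAdjoint_le (h i j hij)))
    (exists_norm_secondAdjoint_le hC) hlim.secondAdjoint

end IsStarPositive

/-- The elements at which a positive functional degenerates are closed under addition. -/
theorem IsPositive.apply_star_add_mul_add {φ : StrongDual ℂ A} (hφ : IsPositive φ) {a b : A}
    (ha : φ (star a * a) = 0) (hb : φ (star b * b) = 0) :
    φ (star (a + b) * (a + b)) = 0 := by
  -- Parallelogram law: both terms on the left have nonnegative values under `φ`, and these sum to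
  -- zero.
  have key : star (a + b) * (a + b) + star (a - b) * (a - b) =
      star a * a + star a * a + (star b * b + star b * b) := by
    simp only [star_add, star_sub]
    noncomm_ring
  have h := congrArg (fun c => (φ c).re) key
  simp only [map_add, ha, hb, Complex.add_re, Complex.zero_re, add_zero] at h
  obtain ⟨h1, h2⟩ := hφ (a + b)
  have h3 := (hφ (a - b)).1
  refine Complex.ext ?_ h2
  rw [Complex.zero_re]
  linarith

theorem IsPositive.apply_star_sum_mul_sum {φ : StrongDual ℂ A} (hφ : IsPositive φ) {ι : Type*}
    (s : Finset ι) (a : ι → A) (ha : ∀ i ∈ s, φ (star (a i) * a i) = 0) :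
    φ (star (∑ i ∈ s, a i) * ∑ i ∈ s, a i) = 0 :=
  Finset.sum_induction a (fun a => φ (star a * a) = 0)
    (fun _ _ => hφ.apply_star_add_mul_add) (by simp) ha

/-- A functional vanishing on the elements `a* a` is zero. -/
theorem eq_zero_of_apply_star_mul_self [PartialOrder A] [StarOrderedRing A]
    {φ : StrongDual ℂ A} (h : ∀ a : A, φ (star a * a) = 0) : φ = 0 := by
  ext a
  -- Positive elements span the algebra, and each has the form `b* b`.
  have ha : a ∈ Submodule.span ℂ {a : A | 0 ≤ a} := by
    rw [CStarAlgebra.span_nonneg]; trivial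
  refine Submodule.span_induction (p := fun a _ => φ a = 0) ?_ (map_zero φ) ?_ ?_ ha
  · intro a ha
    obtain ⟨b, rfl⟩ := CStarAlgebra.nonneg_iff_eq_star_mul_self.1 ha
    exact h b
  · intro a b _ _ ha hb
    rw [map_add, ha, hb, add_zero]
  · intro c a _ ha
    rw [map_smul, ha, smul_zero]

end SecondAdjoint

/-! ### The corner embedding and the diagonal compressions of `M_n(A)` -/

section Corner

variable {A : Type u} [NonUnitalCStarAlgebra A] [PartialOrder A] [StarOrderedRing A] {n : ℕ}

theorem star_singleL (i j : Fin n) (a : A) :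
    star (singleL i j a) = singleL j i (star a) := by
  ext k l
  simp only [CStarMatrix.star_apply]
  change star (entryL l k (singleL i j a)) = entryL k l (singleL j i (star a))
  rw [entryL_singleL, entryL_singleL]
  by_cases h : i = l ∧ j = k
  · rw [if_pos h, if_pos h.symm]
  · rw [if_neg h, if_neg (fun h' => h h'.symm), star_zero]

theorem singleL_mul_singleL (i j k : Fin n) (a b : A) :
    singleL i j a * singleL j k b = singleL i k (a * b) :=
  congrArg CStarMatrix.ofMatrix (Matrix.single_mul_single_same (i := i) (j := j) (k := k) a b)

theorem isStarPositive_singleL (i : Fin n) : IsStarPositive (singleL (A := A) i i) where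
  map_star a := (star_singleL i i a).symm
  comp_isPositive φ hφ a := by
    have := hφ (singleL i i a)
    rwa [star_singleL, singleL_mul_singleL] at this

/-- A diagonal entry of `M* M` is a sum of elements `a* a`, taken over a column of `M`. -/
theorem isStarPositive_entryL (i : Fin n) : IsStarPositive (entryL (A := A) i i) where
  map_star M := rfl
  comp_isPositive φ hφ M := by
    have h : entryL i i (star M * M) = ∑ k, star (M k i) * M k i := rfl
    rw [ContinuousLinearMap.comp_apply, h, map_sum, Complex.re_sum, Complex.im_sum]
    exact ⟨Finset.sum_nonneg fun k _ => (hφ (M k i)).1,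
      Finset.sum_eq_zero fun k _ => (hφ (M k i)).2⟩

/-- A positive functional on `M_n(A)` that vanishes on all diagonal corners is zero. -/
theorem IsPositive.eq_zero_of_comp_singleL {φ : StrongDual ℂ (Mat n A)} (hφ : IsPositive φ)
    (h : ∀ i, φ.comp (singleL i i) = 0) : φ = 0 := by
  let _ : PartialOrder (Mat n A) := CStarAlgebra.spectralOrder _
  have : StarOrderedRing (Mat n A) := CStarAlgebra.spectralOrderedRing _
  refine eq_zero_of_apply_star_mul_self fun M => ?_
  -- Each summand `a e_ij` satisfies `(a e_ij)* (a e_ij) = (a* a) e_jj`, which lies in a diagonal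
  -- corner; degeneracy is additive.
  rw [← sum_singleL_entryL M]
  refine hφ.apply_star_sum_mul_sum _ _ fun i _ => hφ.apply_star_sum_mul_sum _ _ fun j _ => ?_
  rw [star_singleL, singleL_mul_singleL]
  exact DFunLike.congr_fun (h j) _

/-- A nonzero positive functional restricts to a nonzero one on some diagonal corner, which can be
normalized. -/
theorem exists_isState_of_mat (h : ∃ φ : StrongDual ℂ (Mat n A), IsState φ) :
    ∃ φ : StrongDual ℂ A, IsState φ := by
  obtain ⟨φ, hφ⟩ := h
  by_contra hA
  refine hφ.ne_zero (hφ.1.eq_zero_of_comp_singleL fun i => ?_)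
  by_contra h0
  exact hA ⟨_, ((isStarPositive_singleL i).comp_isPositive φ hφ.1).isState_normalize h0⟩

theorem exists_isState_mat [NeZero n] (h : ∃ φ : StrongDual ℂ A, IsState φ) :
    ∃ φ : StrongDual ℂ (Mat n A), IsState φ := by
  obtain ⟨φ, hφ⟩ := h
  refine ⟨_, ((isStarPositive_entryL (0 : Fin n)).comp_isPositive φ hφ.1).isState_normalize
    fun h0 => hφ.ne_zero ?_⟩
  ext a
  -- The pullback along the compression still recovers `φ` on the corner, so it cannot vanish.
  simpa [entryL_singleL] using DFunLike.congr_fun h0 (singleL 0 0 a)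

theorem e11_eq_secondAdjoint [NeZero n] (x : Bidual A) :
    e11 n x = secondAdjoint (singleL 0 0) x := by
  refine (LinearEquiv.symm_apply_eq _).2 ?_
  ext i j φ
  have : (φ.comp (entryL i j)).comp (singleL (A := A) 0 0)
      = if (0 : Fin n) = i ∧ (0 : Fin n) = j then φ else 0 := by
    ext a
    rw [ContinuousLinearMap.comp_apply, ContinuousLinearMap.comp_apply, entryL_singleL]
    split_ifs <;> simp
  change Matrix.single 0 0 x i j φ = x ((φ.comp (entryL i j)).comp (singleL 0 0))
  rw [this, Matrix.single_apply]
  split_ifs <;> simp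

theorem secondAdjoint_entryL_e11 [NeZero n] (x : Bidual A) :
    secondAdjoint (entryL 0 0) (e11 n x) = x := by
  change matEquiv n A ((matEquiv n A).symm (Matrix.single 0 0 x)) 0 0 = x
  rw [LinearEquiv.apply_symm_apply, Matrix.single_apply_same]

end Corner

end CStarBidual

open CStarBidual in
theorem lemma2 {A : Type*} [NonUnitalCStarAlgebra A] [PartialOrder A] [StarOrderedRing A]
    (n : ℕ) [NeZero n] (x : CStarBidual.Bidual A) (hx : CStarBidual.bidualStar x = x) :
    (x ∈ CStarBidual.SBar A ↔
      CStarBidual.e11 n x ∈ CStarBidual.SBar (CStarBidual.Mat n A)) ∧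
    (x ∈ CStarBidual.Ub A ↔
      CStarBidual.e11 n x ∈ CStarBidual.Ub (CStarBidual.Mat n A)) ∧
    (x ∈ CStarBidual.UbBar A ↔
      CStarBidual.e11 n x ∈ CStarBidual.UbBar (CStarBidual.Mat n A)) ∧
    (x ∈ CStarBidual.U0 A ↔
      CStarBidual.e11 n x ∈ CStarBidual.U0 (CStarBidual.Mat n A)) ∧
    (x ∈ CStarBidual.U A ↔
      CStarBidual.e11 n x ∈ CStarBidual.U (CStarBidual.Mat n A)) := by
  have hs := isStarPositive_singleL (A := A) (0 : Fin n)
  have he := isStarPositive_entryL (A := A) (0 : Fin n)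
  have key : ∀ {R : Set (Bidual A)} {R' : Set (Bidual (Mat n A))},
      (∀ {y}, y ∈ R → secondAdjoint (singleL 0 0) y ∈ R') →
      (∀ {y}, y ∈ R' → secondAdjoint (entryL 0 0) y ∈ R) → (x ∈ R ↔ e11 n x ∈ R') := by
    intro R R' h1 h2
    refine ⟨fun h => e11_eq_secondAdjoint (n := n) x ▸ h1 h, fun h => ?_⟩
    rw [← secondAdjoint_entryL_e11 (n := n) x]
    exact h2 h
  exact ⟨key hs.secondAdjoint_mem_SBar he.secondAdjoint_mem_SBar,
    key (hs.secondAdjoint_mem_Ub exists_isState_of_mat)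
      (he.secondAdjoint_mem_Ub exists_isState_mat),
    key (hs.secondAdjoint_mem_UbBar exists_isState_of_mat)
      (he.secondAdjoint_mem_UbBar exists_isState_mat),
    key (hs.secondAdjoint_mem_U0 exists_isState_of_mat)
      (he.secondAdjoint_mem_U0 exists_isState_mat),
    key (hs.secondAdjoint_mem_U exists_isState_of_mat)
      (he.secondAdjoint_mem_U exists_isState_mat)⟩
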